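/- **Theorem (Completeness of the sequent calculus $\mathbf G$).** Let $\mathsf{Prop}$ and $\mathsf{Nom}$ be countably infinite sets (propositions, nominals) and let $\mathsf{Mod}$ and $\mathsf{Cmp}$ be finite sets (modalities, data comparisons), all pairwise disjoint. *Path expressions* $\alpha,\beta$ and *node expressions* $\varphi,\psi$ are given by $$\alpha,\beta ::= a \mid i{:} \mid \varphi? \mid \alpha\beta,\qquad \varphi,\psi ::= p \mid i \mid \bot \mid \varphi\to\psi \mid @_i\varphi \mid \langle a\rangle\varphi \mid \langle\alpha =_c \beta\rangle \mid \langle\alpha\neq_c\beta\rangle ,$$ with $p\in\mathsf{Prop}$, $i\in\mathsf{Nom}$, $a\in\mathsf{Mod}$, $c\in\mathsf{Cmp}$. Write $\blacktriangle$ for any of the symbols $=_c$, $\neq_c$. Put $\neg\varphi:=\varphi\to\bot$, $\varphi\wedge\psi:=\neg(\varphi\to\neg\psi)$, $\langle j{:}\rangle\varphi:=@_j\varphi$, $\langle\psi?\rangle\varphi:=\psi\wedge\varphi$ and $\langle\alpha\beta\rangle\varphi:=\langle\alpha\rangle\langle\beta\rangle\varphi$. A *model* $\mathfrak M$ consists of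 a non-empty set $N$, a binary relation $R_a$ on $N$ for each $a\in\mathsf{Mod}$, an equivalence relation $\approx_c$ on $N$ for each $c\in\mathsf{Cmp}$, a map $g:\mathsf{Nom}\to N$ and a map $V:\mathsf{Prop}\to 2^N$. Satisfaction is defined by: $n,n'\Vdash a$ iff $n R_a n'$; $n,n'\Vdash i{:}$ iff $g(i)=n'$; $n,n'\Vdash\varphi?$ iff $n=n'$ and $n\Vdash\varphi$; $n,n'\Vdash\alpha\beta$ iff $n,m\Vdash\alpha$ and $m,n'\Vdash\beta$ for some $m$; $n\Vdash p$ iff $n\in V(p)$; $n\Vdash i$ iff $g(i)=n$; $n\Vdash\bot$ never; $n\Vdash\varphi\to\psi$ iff $n\Vdash\varphi$ implies $n\Vdash\psi$; $n\Vdash @_i\varphi$ iff $g(i)\Vdash\varphi$; $n\Vdash\langle a\rangle\varphi$ iff $nR_an'$ and $n'\Vdash\varphi$ for some $n'$; $n\Vdash\langle\alpha=_c\beta\rangle$ (resp. $\langle\alpha\neq_c\beta\rangle$) iff there are $n',n''$ with $n,n'\Vdash\alpha$, $n,n''\Vdash\beta$ and $n'\approx_c n''$ (resp. $n'\not\approx_c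 n''$). Write $\mathfrak M\Vdash\varphi$ if $\varphi$ holds at every node. A *sequent* $\Gamma\vdash\Delta$ is a pair of finite, possibly empty sets of node expressions of the form $@_i\varphi$ or $\langle i{:}\blacktriangle j{:}\rangle$. It is *valid* if, for every model $\mathfrak M$, whenever $\mathfrak M\Vdash\gamma$ for all $\gamma\in\Gamma$, then $\mathfrak M\Vdash\delta$ for some $\delta\in\Delta$. It is *provable in $\mathbf G$* if it is the root of a finite tree of sequents built with the following rules (premisses $\Rightarrow$ conclusion), every leaf being an instance of (Ax) or ($\bot$); a comma denotes union of sets. * (Ax) $\Rightarrow\ \chi,\Gamma\vdash\Delta,\chi$, for $\chi$ of the form $@_ip$, $@_ij$ or $\langle i{:}=_cj{:}\rangle$. ($\bot$) $\Rightarrow\ @_i\bot,\Gamma\vdash\Delta$. * (${\to}$L) $\Gamma\vdash\Delta,@_i\varphi$ and $@_i\psi,\Gamma\vdash\Delta\ \Rightarrow\ @_i(\varphi\to\psi),\Gamma\vdash\Delta$. (${\to}$R) $@_i\varphi,\Gamma\vdash\Delta,@_i\psi\ \Rightarrow\ \Gamma\vdash\Delta,@_i(\varphi\to\psi)$. * ($@$T)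 $@_ii,\Gamma\vdash\Delta\ \Rightarrow\ \Gamma\vdash\Delta$. ($@$5) $@_jk,@_ij,@_ik,\Gamma\vdash\Delta\ \Rightarrow\ @_ij,@_ik,\Gamma\vdash\Delta$. (Nom) $@_ij,\Gamma\vdash\Delta\ \Rightarrow\ \Gamma\vdash\Delta$, where $j$ is not in the conclusion. * (S$_1$) $@_j\varphi,@_ij,@_i\varphi,\Gamma\vdash\Delta\ \Rightarrow\ @_ij,@_i\varphi,\Gamma\vdash\Delta$, for $\varphi$ of the form $p$, $\bot$ or $\langle a\rangle k$. (S$_2$) $@_i\langle a\rangle k,@_jk,@_i\langle a\rangle j,\Gamma\vdash\Delta\ \Rightarrow\ @_jk,@_i\langle a\rangle j,\Gamma\vdash\Delta$. (S$_3$) $\langle j{:}=_ck{:}\rangle,@_ij,\langle i{:}=_ck{:}\rangle,\Gamma\vdash\Delta\ \Rightarrow\ @_ij,\langle i{:}=_ck{:}\rangle,\Gamma\vdash\Delta$. * ($@$L) $@_i\varphi,\Gamma\vdash\Delta\ \Rightarrow\ @_j@_i\varphi,\Gamma\vdash\Delta$. ($@$R) $\Gamma\vdash\Delta,@_i\varphi\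 \Rightarrow\ \Gamma\vdash\Delta,@_j@_i\varphi$. * ($\langle a\rangle$L) $@_i\langle a\rangle j,@_j\varphi,\Gamma\vdash\Delta\ \Rightarrow\ @_i\langle a\rangle\varphi,\Gamma\vdash\Delta$, where $j$ is not in the conclusion. ($\langle a\rangle$R) $@_i\langle a\rangle j,\Gamma\vdash\Delta,@_i\langle a\rangle\varphi,@_j\varphi\ \Rightarrow\ @_i\langle a\rangle j,\Gamma\vdash\Delta,@_i\langle a\rangle\varphi$. * ($\langle\blacktriangle\rangle$L) $@_i\langle\alpha\rangle j,@_i\langle\beta\rangle k,\langle j{:}\blacktriangle k{:}\rangle,\Gamma\vdash\Delta\ \Rightarrow\ @_i\langle\alpha\blacktriangle\beta\rangle,\Gamma\vdash\Delta$, where $j\ne k$ are not in the conclusion. ($\langle\blacktriangle\rangle$R) $@_i\langle\alpha\rangle j,@_i\langle\beta\rangle k,\Gamma\vdash\Delta,@_i\langle\alpha\blacktriangle\beta\rangle,\langle j{:}\blacktriangle k{:}\rangle\ \Rightarrow\ @_i\langle\alpha\rangle j,@_i\langle\beta\rangle k,\Gamma\vdash\Delta,@_i\langle\alpha\blacktriangle\beta\rangle$.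 * (EqT) $\langle i{:}=_ci{:}\rangle,\Gamma\vdash\Delta\ \Rightarrow\ \Gamma\vdash\Delta$. (Eq5) $\langle j{:}=_ck{:}\rangle,\langle i{:}=_cj{:}\rangle,\langle i{:}=_ck{:}\rangle,\Gamma\vdash\Delta\ \Rightarrow\ \langle i{:}=_cj{:}\rangle,\langle i{:}=_ck{:}\rangle,\Gamma\vdash\Delta$. (NEqL) $\Gamma\vdash\Delta,\langle i{:}=_cj{:}\rangle\ \Rightarrow\ \langle i{:}\neq_cj{:}\rangle,\Gamma\vdash\Delta$. (NEqR) $\langle i{:}=_cj{:}\rangle,\Gamma\vdash\Delta\ \Rightarrow\ \Gamma\vdash\Delta,\langle i{:}\neq_cj{:}\rangle$. * (Cut) $\Gamma\vdash\Delta,\chi$ and $\chi,\Gamma'\vdash\Delta'\ \Rightarrow\ \Gamma,\Gamma'\vdash\Delta,\Delta'$. (WL) $\Gamma\vdash\Delta\ \Rightarrow\ \chi,\Gamma\vdash\Delta$. (WR) $\Gamma\vdash\Delta\ \Rightarrow\ \Gamma\vdash\Delta,\chi$. Then every valid sequent is provable in $\mathbf G$. -/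

import Mathlib

universe u uP uN uM uC

namespace HXPath

/-- The comparison symbols written `▲`: either `=_c` or `≠_c`, for a data comparison `c`. -/
inductive CmpOp (Cmp : Type uC) : Type uC
  | eq (c : Cmp)
  | neq (c : Cmp)

mutual
/-- Path expressions `a | i: | φ? | αβ`. -/
inductive Path (Prp : Type uP) (Nom : Type uN) (Mod : Type uM) (Cmp : Type uC) :
    Type (max uP uN uM uC)
  | mod (a : Mod)
  | goto (i : Nom)
  | test (φ : Node Prp Nom Mod Cmp)
  | comp (α β : Path Prp Nom Mod Cmp)
/-- Node expressions `p | i | ⊥ | φ → ψ | @_i φ | ⟨a⟩φ | ⟨α ▲ β⟩`. -/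
inductive Node (Prp : Type uP) (Nom : Type uN) (Mod : Type uM) (Cmp : Type uC) :
    Type (max uP uN uM uC)
  | prop (p : Prp)
  | nom (i : Nom)
  | bot
  | imp (φ ψ : Node Prp Nom Mod Cmp)
  | sat (i : Nom) (φ : Node Prp Nom Mod Cmp)
  | dia (a : Mod) (φ : Node Prp Nom Mod Cmp)
  | data (α : Path Prp Nom Mod Cmp) (d : CmpOp Cmp) (β : Path Prp Nom Mod Cmp)
end

section Language

variable {Prp : Type uP} {Nom : Type uN} {Mod : Type uM} {Cmp : Type uC}

noncomputable instance : DecidableEq (Node Prp Nom Mod Cmp) := Classical.decEq _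

/-- `¬φ := φ → ⊥`. -/
def Node.neg (φ : Node Prp Nom Mod Cmp) : Node Prp Nom Mod Cmp := .imp φ .bot

/-- `φ ∧ ψ := ¬(φ → ¬ψ)`. -/
def Node.conj (φ ψ : Node Prp Nom Mod Cmp) : Node Prp Nom Mod Cmp := (Node.imp φ ψ.neg).neg

/-- The expression `⟨α⟩φ` for an arbitrary path expression `α`: it is primitive when `α` is a
modality, and otherwise abbreviates `⟨j:⟩φ := @_j φ`, `⟨ψ?⟩φ := ψ ∧ φ`,
`⟨αβ⟩φ := ⟨α⟩⟨β⟩φ`. -/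
def Path.diamond : Path Prp Nom Mod Cmp → Node Prp Nom Mod Cmp → Node Prp Nom Mod Cmp
  | .mod a, φ => .dia a φ
  | .goto j, φ => .sat j φ
  | .test ψ, φ => ψ.conj φ
  | .comp α β, φ => α.diamond (β.diamond φ)

mutual
/-- The nominal `i` occurs in a path expression. -/
def Path.Occurs (i : Nom) : Path Prp Nom Mod Cmp → Prop
  | .mod _ => False
  | .goto j => i = j
  | .test φ => φ.Occurs i
  | .comp α β => α.Occurs i ∨ β.Occurs i
/-- The nominal `i` occurs in a node expression. -/
def Node.Occurs (i : Nom) : Node Prp Nom Mod Cmp → Prop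
  | .prop _ => False
  | .nom j => i = j
  | .bot => False
  | .imp φ ψ => φ.Occurs i ∨ ψ.Occurs i
  | .sat j φ => i = j ∨ φ.Occurs i
  | .dia _ φ => φ.Occurs i
  | .data α _ β => α.Occurs i ∨ β.Occurs i
end

end Language

/-- Hybrid data models, with set of nodes `W`. -/
structure Model (Prp : Type uP) (Nom : Type uN) (Mod : Type uM) (Cmp : Type uC)
    (W : Type u) where
  nonempty : Nonempty W
  /-- the accessibility relations -/
  R : Mod → W → W → Prop
  /-- the comparisons, which are equivalence relations -/
  approx : Cmp → Setoid W
  /-- the nominal assignment -/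
  g : Nom → W
  /-- the valuation -/
  V : Prp → Set W

section Semantics

variable {Prp : Type uP} {Nom : Type uN} {Mod : Type uM} {Cmp : Type uC} {W : Type u}

/-- `m ≈_c l` or `m ≉_c l`, according to the comparison symbol. -/
def Model.Compare (A : Model Prp Nom Mod Cmp W) : CmpOp Cmp → W → W → Prop
  | .eq c, n, m => (A.approx c).r n m
  | .neq c, n, m => ¬ (A.approx c).r n m

mutual
/-- `A, n, m ⊩ α`. -/
def Path.Sat (A : Model Prp Nom Mod Cmp W) : Path Prp Nom Mod Cmp → W → W → Prop
  | .mod a, n, m => A.R a n m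
  | .goto i, _, m => A.g i = m
  | .test φ, n, m => n = m ∧ φ.Sat A n
  | .comp α β, n, m => ∃ l : W, α.Sat A n l ∧ β.Sat A l m
/-- `A, n ⊩ φ`. -/
def Node.Sat (A : Model Prp Nom Mod Cmp W) : Node Prp Nom Mod Cmp → W → Prop
  | .prop p, n => n ∈ A.V p
  | .nom i, n => A.g i = n
  | .bot, _ => False
  | .imp φ ψ, n => φ.Sat A n → ψ.Sat A n
  | .sat i φ, _ => φ.Sat A (A.g i)
  | .dia a φ, n => ∃ m : W, A.R a n m ∧ φ.Sat A m
  | .data α d β, n =>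
      ∃ m l : W, α.Sat A n m ∧ β.Sat A n l ∧ A.Compare d m l
end

/-- `A ⊩ φ`: the node expression holds at every node of the model. -/
def Model.Models (A : Model Prp Nom Mod Cmp W) (φ : Node Prp Nom Mod Cmp) : Prop :=
  ∀ n : W, φ.Sat A n

end Semantics

section Calculus

variable {Prp : Type uP} {Nom : Type uN} {Mod : Type uM} {Cmp : Type uC}

/-- Node expressions of the form `@_i φ` or `⟨i: ▲ j:⟩`. -/
def Node.IsSeqExpr (χ : Node Prp Nom Mod Cmp) : Prop :=
  (∃ i φ, χ = .sat i φ) ∨ (∃ i d j, χ = .data (.goto i) d (.goto j))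

variable (Prp Nom Mod Cmp) in
/-- The node expressions that may stand in a sequent. -/
abbrev SeqExpr : Type (max uP uN uM uC) := {χ : Node Prp Nom Mod Cmp // χ.IsSeqExpr}

/-- `@_i φ` as a member of a sequent. -/
def sAt (i : Nom) (φ : Node Prp Nom Mod Cmp) : SeqExpr Prp Nom Mod Cmp :=
  ⟨.sat i φ, Or.inl ⟨i, φ, rfl⟩⟩

/-- `⟨i: ▲ j:⟩` as a member of a sequent. -/
def sData (i : Nom) (d : CmpOp Cmp) (j : Nom) : SeqExpr Prp Nom Mod Cmp :=
  ⟨.data (.goto i) d (.goto j), Or.inr ⟨i, d, j, rfl⟩⟩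

variable (Prp Nom Mod Cmp) in
/-- A sequent `Γ ⊢ Δ` is a pair of finite sets. -/
structure Sequent : Type (max uP uN uM uC) where
  ante : Finset (SeqExpr Prp Nom Mod Cmp)
  cons : Finset (SeqExpr Prp Nom Mod Cmp)

infix:40 " ⊢ₛ " => Sequent.mk

/-- Every model of the antecedent is a model of some member of the consequent. -/
def Sequent.Valid (S : Sequent Prp Nom Mod Cmp) : Prop :=
  ∀ (W : Type u) (A : Model Prp Nom Mod Cmp W),
    (∀ γ ∈ S.ante, A.Models γ.1) → ∃ δ ∈ S.cons, A.Models δ.1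

/-- The nominal `j` does not occur in the sequent. -/
def Sequent.Fresh (j : Nom) (S : Sequent Prp Nom Mod Cmp) : Prop :=
  (∀ γ ∈ S.ante, ¬ γ.1.Occurs j) ∧ (∀ δ ∈ S.cons, ¬ δ.1.Occurs j)

/-- The forms `@_i p`, `@_i j`, `⟨i: =_c j:⟩` admitted in (Ax). -/
def SeqExpr.IsAtom (χ : SeqExpr Prp Nom Mod Cmp) : Prop :=
  (∃ i p, χ = sAt i (.prop p)) ∨ (∃ i j, χ = sAt i (.nom j)) ∨
    (∃ i c j, χ = sData i (.eq c) j)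

/-- The forms `p`, `⊥`, `⟨a⟩k` admitted in (S₁). -/
def Node.IsTransferable (φ : Node Prp Nom Mod Cmp) : Prop :=
  (∃ p, φ = .prop p) ∨ φ = .bot ∨ (∃ a k, φ = .dia a (.nom k))

/-- Provability in the sequent calculus `G`: the sequents with a derivation tree all of whose
leaves are instances of (Ax) or (⊥). As antecedents and consequents are sets, `insert φ Γ` is
what is written `φ, Γ`. -/
inductive Sequent.Provable : Sequent Prp Nom Mod Cmp → Prop
  -- Propositional rules
  | ax {Γ Δ} (χ : SeqExpr Prp Nom Mod Cmp) : χ.IsAtom →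
      Provable (insert χ Γ ⊢ₛ insert χ Δ)
  | botL {Γ Δ} (i : Nom) :
      Provable (insert (sAt i .bot) Γ ⊢ₛ Δ)
  | impL {Γ Δ} (i : Nom) (φ ψ : Node Prp Nom Mod Cmp) :
      Provable (Γ ⊢ₛ insert (sAt i φ) Δ) →
      Provable (insert (sAt i ψ) Γ ⊢ₛ Δ) →
      Provable (insert (sAt i (.imp φ ψ)) Γ ⊢ₛ Δ)
  | impR {Γ Δ} (i : Nom) (φ ψ : Node Prp Nom Mod Cmp) :
      Provable (insert (sAt i φ) Γ ⊢ₛ insert (sAt i ψ) Δ) →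
      Provable (Γ ⊢ₛ insert (sAt i (.imp φ ψ)) Δ)
  -- Rules for nominals
  | atT {Γ Δ} (i : Nom) :
      Provable (insert (sAt i (.nom i)) Γ ⊢ₛ Δ) →
      Provable (Γ ⊢ₛ Δ)
  | at5 {Γ Δ} (i j k : Nom) :
      Provable (insert (sAt j (.nom k))
        (insert (sAt i (.nom j)) (insert (sAt i (.nom k)) Γ)) ⊢ₛ Δ) →
      Provable (insert (sAt i (.nom j)) (insert (sAt i (.nom k)) Γ) ⊢ₛ Δ)
  | nom {Γ Δ} (i j : Nom) : Fresh j (Γ ⊢ₛ Δ) →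
      Provable (insert (sAt i (.nom j)) Γ ⊢ₛ Δ) →
      Provable (Γ ⊢ₛ Δ)
  | s1 {Γ Δ} (i j : Nom) (φ : Node Prp Nom Mod Cmp) : φ.IsTransferable →
      Provable (insert (sAt j φ) (insert (sAt i (.nom j)) (insert (sAt i φ) Γ)) ⊢ₛ Δ) →
      Provable (insert (sAt i (.nom j)) (insert (sAt i φ) Γ) ⊢ₛ Δ)
  | s2 {Γ Δ} (i j k : Nom) (a : Mod) :
      Provable (insert (sAt i (.dia a (.nom k)))
        (insert (sAt j (.nom k)) (insert (sAt i (.dia a (.nom j))) Γ)) ⊢ₛ Δ) →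
      Provable (insert (sAt j (.nom k)) (insert (sAt i (.dia a (.nom j))) Γ) ⊢ₛ Δ)
  | s3 {Γ Δ} (i j k : Nom) (c : Cmp) :
      Provable (insert (sData j (.eq c) k)
        (insert (sAt i (.nom j)) (insert (sData i (.eq c) k) Γ)) ⊢ₛ Δ) →
      Provable (insert (sAt i (.nom j)) (insert (sData i (.eq c) k) Γ) ⊢ₛ Δ)
  -- Rules for modalities
  | atL {Γ Δ} (i j : Nom) (φ : Node Prp Nom Mod Cmp) :
      Provable (insert (sAt i φ) Γ ⊢ₛ Δ) →
      Provable (insert (sAt j (.sat i φ)) Γ ⊢ₛ Δ)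
  | atR {Γ Δ} (i j : Nom) (φ : Node Prp Nom Mod Cmp) :
      Provable (Γ ⊢ₛ insert (sAt i φ) Δ) →
      Provable (Γ ⊢ₛ insert (sAt j (.sat i φ)) Δ)
  | diaL {Γ Δ} (i j : Nom) (a : Mod) (φ : Node Prp Nom Mod Cmp) :
      Fresh j (insert (sAt i (.dia a φ)) Γ ⊢ₛ Δ) →
      Provable (insert (sAt i (.dia a (.nom j))) (insert (sAt j φ) Γ) ⊢ₛ Δ) →
      Provable (insert (sAt i (.dia a φ)) Γ ⊢ₛ Δ)
  | diaR {Γ Δ} (i j : Nom) (a : Mod) (φ : Node Prp Nom Mod Cmp) :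
      Provable (insert (sAt i (.dia a (.nom j))) Γ ⊢ₛ
        insert (sAt i (.dia a φ)) (insert (sAt j φ) Δ)) →
      Provable (insert (sAt i (.dia a (.nom j))) Γ ⊢ₛ insert (sAt i (.dia a φ)) Δ)
  | dataL {Γ Δ} (i j k : Nom) (d : CmpOp Cmp) (α β : Path Prp Nom Mod Cmp) : j ≠ k →
      Fresh j (insert (sAt i (.data α d β)) Γ ⊢ₛ Δ) →
      Fresh k (insert (sAt i (.data α d β)) Γ ⊢ₛ Δ) →
      Provable (insert (sAt i (α.diamond (.nom j)))
        (insert (sAt i (β.diamond (.nom k))) (insert (sData j d k) Γ)) ⊢ₛ Δ) →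
      Provable (insert (sAt i (.data α d β)) Γ ⊢ₛ Δ)
  | dataR {Γ Δ} (i j k : Nom) (d : CmpOp Cmp) (α β : Path Prp Nom Mod Cmp) :
      Provable (insert (sAt i (α.diamond (.nom j))) (insert (sAt i (β.diamond (.nom k))) Γ) ⊢ₛ
        insert (sAt i (.data α d β)) (insert (sData j d k) Δ)) →
      Provable (insert (sAt i (α.diamond (.nom j))) (insert (sAt i (β.diamond (.nom k))) Γ) ⊢ₛ
        insert (sAt i (.data α d β)) Δ)
  -- Rules for data comparison
  | eqT {Γ Δ} (i : Nom) (c : Cmp) :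
      Provable (insert (sData i (.eq c) i) Γ ⊢ₛ Δ) →
      Provable (Γ ⊢ₛ Δ)
  | eq5 {Γ Δ} (i j k : Nom) (c : Cmp) :
      Provable (insert (sData j (.eq c) k)
        (insert (sData i (.eq c) j) (insert (sData i (.eq c) k) Γ)) ⊢ₛ Δ) →
      Provable (insert (sData i (.eq c) j) (insert (sData i (.eq c) k) Γ) ⊢ₛ Δ)
  | neqL {Γ Δ} (i j : Nom) (c : Cmp) :
      Provable (Γ ⊢ₛ insert (sData i (.eq c) j) Δ) →
      Provable (insert (sData i (.neq c) j) Γ ⊢ₛ Δ)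
  | neqR {Γ Δ} (i j : Nom) (c : Cmp) :
      Provable (insert (sData i (.eq c) j) Γ ⊢ₛ Δ) →
      Provable (Γ ⊢ₛ insert (sData i (.neq c) j) Δ)
  -- Structural rules
  | cut {Γ Δ Γ₂ Δ₂} (χ : SeqExpr Prp Nom Mod Cmp) :
      Provable (Γ ⊢ₛ insert χ Δ) →
      Provable (insert χ Γ₂ ⊢ₛ Δ₂) →
      Provable (Γ ∪ Γ₂ ⊢ₛ Δ ∪ Δ₂)
  | weakL {Γ Δ} (χ : SeqExpr Prp Nom Mod Cmp) :
      Provable (Γ ⊢ₛ Δ) → Provable (insert χ Γ ⊢ₛ Δ)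
  | weakR {Γ Δ} (χ : SeqExpr Prp Nom Mod Cmp) :
      Provable (Γ ⊢ₛ Δ) → Provable (Γ ⊢ₛ insert χ Δ)

end Calculus

end HXPath

/-!
The proof is a Henkin construction. Since (Cut) is a rule of the calculus, an unprovable sequent
`Γ ⊢ Δ` stays unprovable when a given expression is added to one of its two sides
(`exists_decided_extension`). If it is added on the left and has the form `@_i ⟨a⟩φ` or
`@_i ⟨α ▲ β⟩`, the witnesses demanded by (⟨a⟩L) or (⟨▲⟩L) can be added along with it, because
infinitely many nominals do not occur in the sequent. There are countably many expressions, so a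
generic directed family of unprovable sequents decides all of them, and the union of the
antecedents is a set `T` (`exists_isHenkin`) that contains a member of the consequent of every
provable sequent whose antecedent it includes, and that has witnesses.

The nodes of the canonical model are the nominals, identified when `@_i j ∈ T`. The rules for
nominals and for data comparison ensure that this is an equivalence relation, that `≈_c` is
one, and that both are compatible with the remaining structure. The truth lemma
`sat_canonicalModel` then goes by simultaneous induction on node and path expressions, where the
claim about a path expression `α` is that `@_i ⟨α⟩ψ ∈ T` has the expected meaning for every `ψ`
that already satisfies the truth lemma. As the canonical model is countable, a copy of it lives in
any universe.
-/

namespace HXPath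

variable {Prp : Type uP} {Nom : Type uN} {Mod : Type uM} {Cmp : Type uC}

/-! ### Countability of the language -/

section Encoding

variable (p : Prp → ℕ) (n : Nom → ℕ) (m : Mod → ℕ) (c : CmpOp Cmp → ℕ)

mutual
/-- A numbering of the path expressions, from numberings of the symbols. -/
def Path.code : Path Prp Nom Mod Cmp → ℕ
  | .mod a => Nat.pair 0 (m a)
  | .goto i => Nat.pair 1 (n i)
  | .test φ => Nat.pair 2 φ.code
  | .comp α β => Nat.pair 3 (Nat.pair α.code β.code)
/-- A numbering of the node expressions, from numberings of the symbols. -/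
def Node.code : Node Prp Nom Mod Cmp → ℕ
  | .prop q => Nat.pair 0 (p q)
  | .nom i => Nat.pair 1 (n i)
  | .bot => Nat.pair 2 0
  | .imp φ ψ => Nat.pair 3 (Nat.pair φ.code ψ.code)
  | .sat i φ => Nat.pair 4 (Nat.pair (n i) φ.code)
  | .dia a φ => Nat.pair 5 (Nat.pair (m a) φ.code)
  | .data α d β => Nat.pair 6 (Nat.pair (c d) (Nat.pair α.code β.code))
end

variable {p n m c} (hp : p.Injective) (hn : n.Injective) (hm : m.Injective) (hc : c.Injective)

mutual
theorem Path.code_injective (hp : p.Injective) (hn : n.Injective) (hm : m.Injective)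
    (hc : c.Injective) : ∀ α β : Path Prp Nom Mod Cmp,
      α.code p n m c = β.code p n m c → α = β
  | .mod a, β, h => by
    cases β <;> simp [Path.code, Nat.pair_eq_pair] at h
    rw [hm h]
  | .goto i, β, h => by
    cases β <;> simp [Path.code, Nat.pair_eq_pair] at h
    rw [hn h]
  | .test φ, β, h => by
    cases β <;> simp [Path.code, Nat.pair_eq_pair] at h
    rw [Node.code_injective hp hn hm hc φ _ h]
  | .comp α₁ α₂, β, h => by
    cases β <;> simp [Path.code, Nat.pair_eq_pair] at h
    rw [Path.code_injective hp hn hm hc α₁ _ h.1, Path.code_injective hp hn hm hc α₂ _ h.2]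
theorem Node.code_injective (hp : p.Injective) (hn : n.Injective) (hm : m.Injective)
    (hc : c.Injective) : ∀ φ ψ : Node Prp Nom Mod Cmp,
      φ.code p n m c = ψ.code p n m c → φ = ψ
  | .prop q, ψ, h => by
    cases ψ <;> simp [Node.code, Nat.pair_eq_pair] at h
    rw [hp h]
  | .nom i, ψ, h => by
    cases ψ <;> simp [Node.code, Nat.pair_eq_pair] at h
    rw [hn h]
  | .bot, ψ, h => by
    cases ψ <;> simp [Node.code, Nat.pair_eq_pair] at h
    rfl
  | .imp φ₁ φ₂, ψ, h => by
    cases ψ <;> simp [Node.code, Nat.pair_eq_pair] at h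
    rw [Node.code_injective hp hn hm hc φ₁ _ h.1, Node.code_injective hp hn hm hc φ₂ _ h.2]
  | .sat i φ, ψ, h => by
    cases ψ <;> simp [Node.code, Nat.pair_eq_pair] at h
    rw [hn h.1, Node.code_injective hp hn hm hc φ _ h.2]
  | .dia a φ, ψ, h => by
    cases ψ <;> simp [Node.code, Nat.pair_eq_pair] at h
    rw [hm h.1, Node.code_injective hp hn hm hc φ _ h.2]
  | .data α d β, ψ, h => by
    cases ψ <;> simp [Node.code, Nat.pair_eq_pair] at h
    rw [hc h.1, Path.code_injective hp hn hm hc α _ h.2.1,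
      Path.code_injective hp hn hm hc β _ h.2.2]
end

end Encoding

instance [Countable Cmp] : Countable (CmpOp Cmp) := by
  refine Function.Surjective.countable (α := Cmp ⊕ Cmp) (f := Sum.elim .eq .neq) ?_
  rintro (c | c)
  exacts [⟨.inl c, rfl⟩, ⟨.inr c, rfl⟩]

instance [Countable Prp] [Countable Nom] [Countable Mod] [Countable Cmp] :
    Countable (Node Prp Nom Mod Cmp) := by
  obtain ⟨p, hp⟩ := exists_injective_nat Prp
  obtain ⟨n, hn⟩ := exists_injective_nat Nom
  obtain ⟨m, hm⟩ := exists_injective_nat Mod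
  obtain ⟨c, hc⟩ := exists_injective_nat (CmpOp Cmp)
  exact ⟨⟨Node.code p n m c, fun φ ψ h => Node.code_injective hp hn hm hc φ ψ h⟩⟩

/-! ### Fresh nominals -/

mutual
theorem Path.finite_occurs : ∀ α : Path Prp Nom Mod Cmp, {i | α.Occurs i}.Finite
  | .mod a => by simp [Path.Occurs]
  | .goto i => by simp [Path.Occurs]
  | .test φ => by simpa [Path.Occurs] using φ.finite_occurs
  | .comp α β => by
    simpa [Path.Occurs, Set.ofPred_or] using ⟨α.finite_occurs, β.finite_occurs⟩
theorem Node.finite_occurs : ∀ φ : Node Prp Nom Mod Cmp, {i | φ.Occurs i}.Finite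
  | .prop p => by simp [Node.Occurs]
  | .nom i => by simp [Node.Occurs]
  | .bot => by simp [Node.Occurs]
  | .imp φ ψ => by
    simpa only [Node.Occurs, Set.ofPred_or] using φ.finite_occurs.union ψ.finite_occurs
  | .sat i φ => by
    have h : {j | j = i}.Finite := Set.finite_singleton i
    simpa only [Node.Occurs, Set.ofPred_or] using h.union φ.finite_occurs
  | .dia a φ => by simpa only [Node.Occurs] using φ.finite_occurs
  | .data α d β => by
    simpa only [Node.Occurs, Set.ofPred_or] using α.finite_occurs.union β.finite_occurs
end

theorem Sequent.infinite_fresh [Infinite Nom] (S : Sequent Prp Nom Mod Cmp) :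
    {j | S.Fresh j}.Infinite := by
  have h : ∀ A : Finset (SeqExpr Prp Nom Mod Cmp), (⋃ γ ∈ A, {i | γ.1.Occurs i}).Finite :=
    fun A => A.finite_toSet.biUnion fun γ _ => γ.1.finite_occurs
  refine ((h S.ante).union (h S.cons)).infinite_compl.mono fun j hj => ?_
  simpa [Sequent.Fresh] using hj

/-! ### Semantics of the derived connectives -/

section Semantics

variable {W : Type u} (A : Model Prp Nom Mod Cmp W)

theorem Node.sat_conj (φ ψ : Node Prp Nom Mod Cmp) (w : W) :
    (φ.conj ψ).Sat A w ↔ φ.Sat A w ∧ ψ.Sat A w := by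
  simp [Node.conj, Node.neg, Node.Sat]

theorem Path.sat_diamond : ∀ (α : Path Prp Nom Mod Cmp) (ψ : Node Prp Nom Mod Cmp) (w : W),
    (α.diamond ψ).Sat A w ↔ ∃ v, α.Sat A w v ∧ ψ.Sat A v
  | .mod a, ψ, w => by simp only [Path.diamond, Node.Sat, Path.Sat]
  | .goto i, ψ, w => by simp only [Path.diamond, Node.Sat, Path.Sat, exists_eq_left']
  | .test φ, ψ, w => by
    simp only [Path.diamond, Node.sat_conj, Path.Sat, and_assoc, exists_eq_left']
  | .comp α β, ψ, w => by
    simp only [Path.diamond, Path.sat_diamond α, Path.sat_diamond β, Path.Sat]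
    exact ⟨fun ⟨l, h, v, h', hv⟩ => ⟨v, ⟨l, h, h'⟩, hv⟩,
      fun ⟨v, ⟨l, h, h'⟩, hv⟩ => ⟨l, h, v, h', hv⟩⟩

theorem Path.sat_diamond_nom (α : Path Prp Nom Mod Cmp) (k : Nom) (w : W) :
    (α.diamond (.nom k)).Sat A w ↔ α.Sat A w (A.g k) := by
  simp [Path.sat_diamond, Node.Sat]

end Semantics

/-! ### Derived rules -/

namespace Sequent.Provable

variable {Γ Δ Γ' Δ' : Finset (SeqExpr Prp Nom Mod Cmp)}

theorem weaken (h : (Γ ⊢ₛ Δ).Provable) (hΓ : Γ ⊆ Γ') (hΔ : Δ ⊆ Δ') : (Γ' ⊢ₛ Δ').Provable := by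
  have hL : ∀ A : Finset (SeqExpr Prp Nom Mod Cmp), (A ∪ Γ ⊢ₛ Δ).Provable := fun A => by
    induction A using Finset.induction_on with
    | empty => simpa using h
    | insert χ A _ ih => simpa [Finset.insert_union] using ih.weakL χ
  have hR : ∀ A : Finset (SeqExpr Prp Nom Mod Cmp), (Γ' ∪ Γ ⊢ₛ A ∪ Δ).Provable := fun A => by
    induction A using Finset.induction_on with
    | empty => simpa using hL Γ'
    | insert χ A _ ih => simpa [Finset.insert_union] using ih.weakR χ
  simpa [Finset.union_eq_left.2 hΓ, Finset.union_eq_left.2 hΔ] using hR Δ'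

theorem of_mem_atom {χ : SeqExpr Prp Nom Mod Cmp} (h : χ.IsAtom) (hΓ : χ ∈ Γ) (hΔ : χ ∈ Δ) :
    (Γ ⊢ₛ Δ).Provable := by
  simpa [hΓ, hΔ] using ax (Γ := Γ) (Δ := Δ) χ h

theorem of_mem_sData {i j : Nom} {d : CmpOp Cmp} (hΓ : sData i d j ∈ Γ) (hΔ : sData i d j ∈ Δ) :
    (Γ ⊢ₛ Δ).Provable := by
  cases d with
  | eq c => exact of_mem_atom (.inr (.inr ⟨i, c, j, rfl⟩)) hΓ hΔ
  | neq c =>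
    rw [← Finset.insert_eq_of_mem hΓ, ← Finset.insert_eq_of_mem hΔ]
    exact neqL _ _ _ (.weaken (neqR (Γ := Γ) (Δ := insert (sData i (.eq c) j) Δ) i j c
      (of_mem_atom (.inr (.inr ⟨i, c, j, rfl⟩)) (by simp) (by simp))) le_rfl
      (Finset.insert_comm _ _ _).le)

variable [Infinite Nom]

theorem of_mem_sAt : ∀ (φ : Node Prp Nom Mod Cmp) (i : Nom)
    {Γ Δ : Finset (SeqExpr Prp Nom Mod Cmp)}, sAt i φ ∈ Γ → sAt i φ ∈ Δ → (Γ ⊢ₛ Δ).Provable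
  | .prop p, i, _, _, hΓ, hΔ => of_mem_atom (.inl ⟨i, p, rfl⟩) hΓ hΔ
  | .nom j, i, _, _, hΓ, hΔ => of_mem_atom (.inr (.inl ⟨i, j, rfl⟩)) hΓ hΔ
  | .bot, i, Γ, Δ, hΓ, hΔ => by
    rw [← Finset.insert_eq_of_mem hΓ]
    exact botL i
  | .imp φ ψ, i, Γ, Δ, hΓ, hΔ => by
    rw [← Finset.insert_eq_of_mem hΔ]
    refine impR _ _ _ ?_
    rw [← Finset.insert_eq_of_mem (Finset.mem_insert_of_mem hΓ)]
    exact impL _ _ _ (of_mem_sAt φ i (by simp) (by simp)) (of_mem_sAt ψ i (by simp) (by simp))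
  | .sat j φ, i, Γ, Δ, hΓ, hΔ => by
    rw [← Finset.insert_eq_of_mem hΓ, ← Finset.insert_eq_of_mem hΔ]
    exact atR _ _ _ (atL _ _ _ (of_mem_sAt φ j (by simp) (by simp)))
  | .dia a φ, i, Γ, Δ, hΓ, hΔ => by
    rw [← Finset.insert_eq_of_mem hΓ, ← Finset.insert_eq_of_mem hΔ]
    obtain ⟨j, hj⟩ := (infinite_fresh
      (insert (sAt i (.dia a φ)) Γ ⊢ₛ insert (sAt i (.dia a φ)) Δ)).nonempty
    exact diaL i j a φ hj (diaR _ _ _ _ (of_mem_sAt φ j (by simp) (by simp)))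
  | .data α d β, i, Γ, Δ, hΓ, hΔ => by
    rw [← Finset.insert_eq_of_mem hΓ, ← Finset.insert_eq_of_mem hΔ]
    obtain ⟨j, hj, k, hk, hjk⟩ := (infinite_fresh
      (insert (sAt i (.data α d β)) Γ ⊢ₛ insert (sAt i (.data α d β)) Δ)).nontrivial
    exact dataL i j k d α β hjk hj hk (dataR _ _ _ _ _ _ (of_mem_sData (i := j) (d := d) (j := k)
      (by simp) (by simp)))

/-- (Ax) for arbitrary expressions. -/
theorem of_mem {χ : SeqExpr Prp Nom Mod Cmp} (hΓ : χ ∈ Γ) (hΔ : χ ∈ Δ) : (Γ ⊢ₛ Δ).Provable := by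
  obtain ⟨_, ⟨i, φ, rfl⟩ | ⟨i, d, j, rfl⟩⟩ := χ
  exacts [of_mem_sAt φ i hΓ hΔ, of_mem_sData hΓ hΔ]

end Sequent.Provable

/-! ### Henkin sets -/

/-- The set `T` contains the witnesses that (⟨a⟩L) and (⟨▲⟩L) demand for `χ`. -/
structure Witnessed (T : Set (SeqExpr Prp Nom Mod Cmp)) (χ : SeqExpr Prp Nom Mod Cmp) : Prop where
  dia : ∀ i a φ, χ = sAt i (.dia a φ) → ∃ j, sAt i (.dia a (.nom j)) ∈ T ∧ sAt j φ ∈ T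
  data : ∀ i α d β, χ = sAt i (.data α d β) → ∃ j k, sAt i (α.diamond (.nom j)) ∈ T ∧
    sAt i (β.diamond (.nom k)) ∈ T ∧ sData j d k ∈ T

theorem Witnessed.mono {T T' : Set (SeqExpr Prp Nom Mod Cmp)} {χ : SeqExpr Prp Nom Mod Cmp}
    (h : Witnessed T χ) (hT : T ⊆ T') : Witnessed T' χ where
  dia i a φ e := (h.dia i a φ e).imp fun _ hj => ⟨hT hj.1, hT hj.2⟩
  data i α d β e := (h.data i α d β e).imp fun _ hj => hj.imp fun _ hk =>
    ⟨hT hk.1, hT hk.2.1, hT hk.2.2⟩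

/-- A set of expressions that is deductively closed and prime, and contains witnesses for its
members. -/
structure IsHenkin (T : Set (SeqExpr Prp Nom Mod Cmp)) : Prop where
  prime : ∀ {Γ Δ}, (Γ ⊢ₛ Δ).Provable → (∀ γ ∈ Γ, γ ∈ T) → ∃ δ ∈ Δ, δ ∈ T
  witnessed : ∀ χ ∈ T, Witnessed T χ

theorem IsHenkin.bot_notMem {T : Set (SeqExpr Prp Nom Mod Cmp)} (hT : IsHenkin T) (i : Nom) :
    sAt i .bot ∉ T := fun h => by
  simpa using hT.prime (.botL (Γ := ∅) (Δ := ∅) i) (by simp [h])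

variable [Infinite Nom]

/-- Fresh nominals serve as witnesses. The expression `χ` itself is kept in the antecedent, which
(⟨a⟩L) and (⟨▲⟩L) permit because antecedents are sets. -/
theorem exists_witnessed_extension {Γ Δ : Finset (SeqExpr Prp Nom Mod Cmp)}
    (h : ¬ (Γ ⊢ₛ Δ).Provable) {χ : SeqExpr Prp Nom Mod Cmp} (hχ : χ ∈ Γ) :
    ∃ Γ', Γ ⊆ Γ' ∧ ¬ (Γ' ⊢ₛ Δ).Provable ∧ Witnessed (Γ' : Set _) χ := by
  rw [← Finset.insert_eq_of_mem hχ] at h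
  by_cases h₁ : ∃ i a φ, χ = sAt i (.dia a φ)
  · obtain ⟨i, a, φ, rfl⟩ := h₁
    obtain ⟨j, hj⟩ := (Sequent.infinite_fresh (insert (sAt i (.dia a φ)) Γ ⊢ₛ Δ)).nonempty
    refine ⟨_, ?_, fun H => h (.diaL i j a φ hj H), ?_, ?_⟩
    · exact (Finset.subset_insert _ _).trans (Finset.subset_insert _ _)
    · intro i' a' φ' e
      cases congrArg Subtype.val e
      exact ⟨j, by simp, by simp⟩
    · intro i' α d β e
      cases congrArg Subtype.val e
  by_cases h₂ : ∃ i α d β, χ = sAt i (.data α d β)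
  · obtain ⟨i, α, d, β, rfl⟩ := h₂
    obtain ⟨j, hj, k, hk, hjk⟩ :=
      (Sequent.infinite_fresh (insert (sAt i (.data α d β)) Γ ⊢ₛ Δ)).nontrivial
    refine ⟨_, ?_, fun H => h (.dataL i j k d α β hjk hj hk H), ?_, ?_⟩
    · exact ((Finset.subset_insert _ _).trans (Finset.subset_insert _ _)).trans
        (Finset.subset_insert _ _)
    · intro i' a φ e
      cases congrArg Subtype.val e
    · intro i' α' d' β' e
      cases congrArg Subtype.val e
      exact ⟨j, k, by simp, by simp, by simp⟩
  · rw [Finset.insert_eq_of_mem hχ] at h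
    exact ⟨Γ, le_rfl, h, fun i a φ e => (h₁ ⟨i, a, φ, e⟩).elim,
      fun i α d β e => (h₂ ⟨i, α, d, β, e⟩).elim⟩

variable (Prp Nom Mod Cmp) in
/-- The unprovable sequents, as pairs of finite sets ordered by inclusion on both sides. -/
abbrev Unprovable : Type _ :=
  {s : Finset (SeqExpr Prp Nom Mod Cmp) × Finset (SeqExpr Prp Nom Mod Cmp) //
    ¬ (s.1 ⊢ₛ s.2).Provable}

/-- If `χ` cannot be added on either side, then (Cut) on `χ` proves the given sequent. -/
theorem exists_decided_extension (χ : SeqExpr Prp Nom Mod Cmp) (s : Unprovable Prp Nom Mod Cmp) :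
    ∃ t : Unprovable Prp Nom Mod Cmp,
      (χ ∈ t.1.1 ∧ Witnessed (t.1.1 : Set _) χ ∨ χ ∈ t.1.2) ∧ s ≤ t := by
  obtain ⟨⟨Γ, Δ⟩, h⟩ := s
  by_cases hL : (insert χ Γ ⊢ₛ Δ).Provable
  · refine ⟨⟨(Γ, insert χ Δ), fun hR => h ?_⟩, .inr (by simp), le_rfl, Finset.subset_insert _ _⟩
    simpa using hR.cut χ hL
  · obtain ⟨Γ', hΓ, h', hw⟩ := exists_witnessed_extension hL (Finset.mem_insert_self χ Γ)
    exact ⟨⟨(Γ', Δ), h'⟩, .inl ⟨hΓ (by simp), hw⟩, (Finset.subset_insert _ _).trans hΓ, le_rfl⟩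

/-- A finite set that is covered by the members of an ideal is included in one of them. -/
theorem exists_mem_ideal_subset {P ι : Type*} [Preorder P] (I : Order.Ideal P) {f : P → Finset ι}
    (hf : Monotone f) (A : Finset ι) (hA : ∀ x ∈ A, ∃ s ∈ I, x ∈ f s) : ∃ s ∈ I, A ⊆ f s := by
  classical
  induction A using Finset.induction_on with
  | empty => exact I.nonempty.imp fun s hs => ⟨hs, by simp⟩
  | insert x A _ ih =>
    obtain ⟨s, hs, hAs⟩ := ih fun y hy => hA y (Finset.mem_insert_of_mem hy)
    obtain ⟨t, ht, hxt⟩ := hA x (Finset.mem_insert_self x A)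
    obtain ⟨r, hr, hsr, htr⟩ := I.directed s hs t ht
    exact ⟨r, hr, Finset.insert_subset (hf htr hxt) (hAs.trans (hf hsr))⟩

/-- An unprovable sequent is refuted by a Henkin set: the union of the antecedents of an ideal of
unprovable sequents that meets, for each `χ`, the cofinal set of sequents that decide `χ`. -/
theorem exists_isHenkin [Countable Prp] [Countable Nom] [Countable Mod] [Countable Cmp]
    {S : Sequent Prp Nom Mod Cmp} (hS : ¬ S.Provable) :
    ∃ T, IsHenkin T ∧ (∀ γ ∈ S.ante, γ ∈ T) ∧ ∀ δ ∈ S.cons, δ ∉ T := by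
  have : Encodable (SeqExpr Prp Nom Mod Cmp) := Encodable.ofCountable _
  let D (χ : SeqExpr Prp Nom Mod Cmp) : Order.Cofinal (Unprovable Prp Nom Mod Cmp) :=
    ⟨{t | χ ∈ t.1.1 ∧ Witnessed (t.1.1 : Set (SeqExpr Prp Nom Mod Cmp)) χ ∨ χ ∈ t.1.2},
      exists_decided_extension χ⟩
  let s₀ : Unprovable Prp Nom Mod Cmp := ⟨(S.ante, S.cons), hS⟩
  let I := Order.idealOfCofinals s₀ D
  have hI (χ) : ∃ t ∈ I, χ ∈ t.1.1 ∧ Witnessed (t.1.1 : Set _) χ ∨ χ ∈ t.1.2 := by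
    obtain ⟨t, ht, ht'⟩ := Order.cofinal_meets_idealOfCofinals s₀ D χ
    exact ⟨t, ht', ht⟩
  have hs₀ : s₀ ∈ I := Order.mem_idealOfCofinals s₀ D
  -- A common upper bound of two sequents of the ideal would be an instance of identity.
  have hdisj {χ s t} (hs : s ∈ I) (ht : t ∈ I) (hχs : χ ∈ s.1.1) : χ ∉ t.1.2 := fun hχt => by
    obtain ⟨r, -, hsr, htr⟩ := I.directed s hs t ht
    exact r.2 (.of_mem (hsr.1 hχs) (htr.2 hχt))
  refine ⟨{χ | ∃ s ∈ I, χ ∈ s.1.1}, ⟨fun {Γ Δ} h hΓ => ?_, ?_⟩, fun γ hγ => ⟨s₀, hs₀, hγ⟩,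
    fun δ hδ ⟨s, hs, h⟩ => hdisj hs hs₀ h hδ⟩
  · by_contra! hΔ
    obtain ⟨s, hs, hΓs⟩ := exists_mem_ideal_subset I (f := fun s => s.1.1)
      (fun _ _ h => h.1) Γ hΓ
    obtain ⟨t, ht, hΔt⟩ := exists_mem_ideal_subset I (f := fun s => s.1.2)
      (fun _ _ h => h.2) Δ fun δ hδ => by
        obtain ⟨t, ht, h | h⟩ := hI δ
        exacts [(hΔ δ hδ ⟨t, ht, h.1⟩).elim, ⟨t, ht, h⟩]
    obtain ⟨r, -, hsr, htr⟩ := I.directed s hs t ht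
    exact r.2 (h.weaken (hΓs.trans hsr.1) (hΔt.trans htr.2))
  · rintro χ ⟨s, hs, hχ⟩
    obtain ⟨t, ht, h | h⟩ := hI χ
    exacts [h.2.mono fun γ hγ => ⟨t, ht, hγ⟩, (hdisj hs ht hχ h).elim]

/-! ### Closure properties of Henkin sets -/

namespace IsHenkin

open Sequent.Provable

variable {T : Set (SeqExpr Prp Nom Mod Cmp)} {i j k : Nom} {a : Mod} {c : Cmp} {φ ψ : Node Prp Nom Mod Cmp}

theorem nom_refl (hT : IsHenkin T) (i : Nom) : sAt i (.nom i) ∈ T := by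
  simpa using hT.prime (atT (Γ := ∅) (Δ := {sAt i (.nom i)}) i (of_mem (by simp)
    (Finset.mem_singleton_self _))) (by simp)

theorem nom_eucl (hT : IsHenkin T) (hj : sAt i (.nom j) ∈ T) (hk : sAt i (.nom k) ∈ T) :
    sAt j (.nom k) ∈ T := by
  simpa using hT.prime (at5 (Γ := ∅) (Δ := {sAt j (.nom k)}) i j k (of_mem (by simp)
    (Finset.mem_singleton_self _))) (by simp [*])

theorem nom_symm (hT : IsHenkin T) (h : sAt i (.nom j) ∈ T) : sAt j (.nom i) ∈ T :=
  hT.nom_eucl h (hT.nom_refl i)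

theorem transfer (hT : IsHenkin T) (hφ : φ.IsTransferable) (hj : sAt i (.nom j) ∈ T)
    (h : sAt i φ ∈ T) : sAt j φ ∈ T := by
  simpa using hT.prime (s1 (Γ := ∅) (Δ := {sAt j φ}) i j φ hφ (of_mem (by simp)
    (Finset.mem_singleton_self _))) (by simp [*])

theorem dia_congr_right (hT : IsHenkin T) (hk : sAt j (.nom k) ∈ T)
    (h : sAt i (.dia a (.nom j)) ∈ T) : sAt i (.dia a (.nom k)) ∈ T := by
  simpa using hT.prime (s2 (Γ := ∅) (Δ := {sAt i (.dia a (.nom k))}) i j k a (of_mem (by simp)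
    (Finset.mem_singleton_self _))) (by simp [*])

theorem data_refl (hT : IsHenkin T) (i : Nom) (c : Cmp) : sData i (.eq c) i ∈ T := by
  simpa using hT.prime (eqT (Γ := ∅) (Δ := {sData i (.eq c) i}) i c (of_mem (by simp)
    (Finset.mem_singleton_self _))) (by simp)

theorem data_eucl (hT : IsHenkin T) (hj : sData i (.eq c) j ∈ T) (hk : sData i (.eq c) k ∈ T) :
    sData j (.eq c) k ∈ T := by
  simpa using hT.prime (eq5 (Γ := ∅) (Δ := {sData j (.eq c) k}) i j k c (of_mem (by simp)
    (Finset.mem_singleton_self _))) (by simp [*])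

theorem data_symm (hT : IsHenkin T) (h : sData i (.eq c) j ∈ T) : sData j (.eq c) i ∈ T :=
  hT.data_eucl h (hT.data_refl i c)

theorem data_congr_left (hT : IsHenkin T) (hj : sAt i (.nom j) ∈ T)
    (h : sData i (.eq c) k ∈ T) : sData j (.eq c) k ∈ T := by
  simpa using hT.prime (s3 (Γ := ∅) (Δ := {sData j (.eq c) k}) i j k c (of_mem (by simp)
    (Finset.mem_singleton_self _))) (by simp [*])

theorem imp_mem_iff (hT : IsHenkin T) :
    sAt i (.imp φ ψ) ∈ T ↔ (sAt i φ ∈ T → sAt i ψ ∈ T) := by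
  refine ⟨fun h hφ => ?_, fun h => ?_⟩
  · simpa using hT.prime (impL (Γ := {sAt i φ}) (Δ := {sAt i ψ}) i φ ψ
      (of_mem (χ := sAt i φ) (by simp) (by simp))
      (of_mem (χ := sAt i ψ) (by simp) (by simp))) (by simp [*])
  · by_cases hφ : sAt i φ ∈ T
    · simpa using hT.prime (impR (Γ := {sAt i ψ}) (Δ := ∅) i φ ψ
        (of_mem (χ := sAt i ψ) (by simp) (by simp))) (by simp [h hφ])
    · simpa [hφ] using hT.prime (impR (Γ := ∅) (Δ := {sAt i φ}) i φ ψ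
        (of_mem (χ := sAt i φ) (by simp) (by simp))) (by simp)

theorem conj_mem_iff (hT : IsHenkin T) :
    sAt i (φ.conj ψ) ∈ T ↔ sAt i φ ∈ T ∧ sAt i ψ ∈ T := by
  simp [Node.conj, Node.neg, hT.imp_mem_iff, hT.bot_notMem]

theorem sat_mem_iff (hT : IsHenkin T) : sAt j (.sat i φ) ∈ T ↔ sAt i φ ∈ T := by
  refine ⟨fun h => ?_, fun h => ?_⟩
  · simpa using hT.prime (atL (Γ := ∅) (Δ := {sAt i φ}) i j φ
      (of_mem (χ := sAt i φ) (by simp) (by simp))) (by simp [*])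
  · simpa using hT.prime (atR (Γ := {sAt i φ}) (Δ := ∅) i j φ
      (of_mem (χ := sAt i φ) (by simp) (by simp))) (by simp [*])

theorem dia_mem_iff (hT : IsHenkin T) :
    sAt i (.dia a φ) ∈ T ↔ ∃ j, sAt i (.dia a (.nom j)) ∈ T ∧ sAt j φ ∈ T := by
  refine ⟨fun h => (hT.witnessed _ h).dia i a φ rfl, fun ⟨j, h, hφ⟩ => ?_⟩
  simpa using hT.prime (diaR (Γ := {sAt j φ}) (Δ := ∅) i j a φ
    (of_mem (χ := sAt j φ) (by simp) (by simp))) (by simp [*])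

theorem data_mem_iff (hT : IsHenkin T) {α β : Path Prp Nom Mod Cmp} {d : CmpOp Cmp} :
    sAt i (.data α d β) ∈ T ↔ ∃ j k, sAt i (α.diamond (.nom j)) ∈ T ∧
      sAt i (β.diamond (.nom k)) ∈ T ∧ sData j d k ∈ T := by
  refine ⟨fun h => (hT.witnessed _ h).data i α d β rfl, fun ⟨j, k, hj, hk, h⟩ => ?_⟩
  simpa using hT.prime (dataR (Γ := {sData j d k}) (Δ := ∅) i j k d α β
    (of_mem (χ := sData j d k) (by simp) (by simp))) (by simp [*])

theorem neq_mem_iff (hT : IsHenkin T) : sData i (.neq c) j ∈ T ↔ sData i (.eq c) j ∉ T := by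
  refine ⟨fun h h' => ?_, fun h => ?_⟩
  · simpa using hT.prime (neqL (Γ := {sData i (.eq c) j}) (Δ := ∅) i j c
      (of_mem (χ := sData i (.eq c) j) (by simp) (by simp))) (by simp [*])
  · simpa [h] using hT.prime (neqR (Γ := ∅) (Δ := {sData i (.eq c) j}) i j c
      (of_mem (χ := sData i (.eq c) j) (by simp) (by simp))) (by simp)

/-- The nominals modulo `@_i j ∈ T`, in an arbitrary universe. -/
theorem exists_naming [Countable Nom] (hT : IsHenkin T) :
    ∃ (W : Type u) (g : Nom → W), g.Surjective ∧ ∀ i j, g i = g j ↔ sAt i (.nom j) ∈ T := by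
  let s : Setoid Nom := ⟨fun i j => sAt i (.nom j) ∈ T, hT.nom_refl, hT.nom_symm,
    fun h h' => hT.nom_eucl (hT.nom_symm h) h'⟩
  refine ⟨Shrink.{u} (Quotient s), fun i => equivShrink _ (Quotient.mk s i),
    (equivShrink _).surjective.comp Quotient.mk_surjective, fun i j => ?_⟩
  rw [(equivShrink _).apply_eq_iff_eq, Quotient.eq]
  rfl

end IsHenkin

/-! ### The canonical model -/

section Canonical

variable {W : Type u} {T : Set (SeqExpr Prp Nom Mod Cmp)} {g : Nom → W}

/-- The canonical model of a Henkin set, on a set of nodes named by the nominals. The relations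
between nodes are read off from chosen names; other names give the same relations when `g`
identifies `i` and `j` exactly if `@_i j ∈ T`. -/
noncomputable def canonicalModel (hT : IsHenkin T) (hg : g.Surjective) :
    Model Prp Nom Mod Cmp W where
  nonempty := (inferInstance : Nonempty Nom).map g
  R a w v := sAt (Function.surjInv hg w) (.dia a (.nom (Function.surjInv hg v))) ∈ T
  approx c :=
    { r w v := sData (Function.surjInv hg w) (.eq c) (Function.surjInv hg v) ∈ T
      iseqv := ⟨fun _ => hT.data_refl _ c, hT.data_symm,
        fun h h' => hT.data_eucl (hT.data_symm h) h'⟩ }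
  g := g
  V p := {w | sAt (Function.surjInv hg w) (.prop p) ∈ T}

theorem canonicalModel_R (hT : IsHenkin T) (hg : g.Surjective)
    (hgT : ∀ i j, g i = g j ↔ sAt i (.nom j) ∈ T) {a : Mod} {i j : Nom} :
    (canonicalModel hT hg).R a (g i) (g j) ↔ sAt i (.dia a (.nom j)) ∈ T := by
  have hi := (hgT _ _).1 (Function.surjInv_eq hg (g i))
  have hj := (hgT _ _).1 (Function.surjInv_eq hg (g j))
  have tr : ∀ k, (Node.dia a (.nom k) : Node Prp Nom Mod Cmp).IsTransferable :=
    fun k => .inr (.inr ⟨a, k, rfl⟩)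
  exact ⟨fun h => hT.dia_congr_right hj (hT.transfer (tr _) hi h),
    fun h => hT.dia_congr_right (hT.nom_symm hj) (hT.transfer (tr _) (hT.nom_symm hi) h)⟩

theorem canonicalModel_compare (hT : IsHenkin T) (hg : g.Surjective)
    (hgT : ∀ i j, g i = g j ↔ sAt i (.nom j) ∈ T) {d : CmpOp Cmp} {i j : Nom} :
    (canonicalModel hT hg).Compare d (g i) (g j) ↔ sData i d j ∈ T := by
  have key (c : Cmp) : ((canonicalModel hT hg).approx c).r (g i) (g j) ↔ sData i (.eq c) j ∈ T := by
    have hi := (hgT _ _).1 (Function.surjInv_eq hg (g i))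
    have hj := (hgT _ _).1 (Function.surjInv_eq hg (g j))
    -- (S₃) replaces the left nominal only; symmetry carries it over to the right one.
    have congr {i i' j j' : Nom} (hi : sAt i (.nom i') ∈ T) (hj : sAt j (.nom j') ∈ T)
        (h : sData i (.eq c) j ∈ T) : sData i' (.eq c) j' ∈ T :=
      hT.data_symm (hT.data_congr_left hj (hT.data_symm (hT.data_congr_left hi h)))
    exact ⟨congr hi hj, congr (hT.nom_symm hi) (hT.nom_symm hj)⟩
  cases d with
  | eq c => exact key c
  | neq c => exact (not_congr (key c)).trans hT.neq_mem_iff.symm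

mutual
/-- The part of the truth lemma that concerns path expressions. -/
theorem sat_canonicalModel_diamond (hT : IsHenkin T) (hg : g.Surjective)
    (hgT : ∀ i j, g i = g j ↔ sAt i (.nom j) ∈ T) : ∀ (α : Path Prp Nom Mod Cmp)
    (ψ : Node Prp Nom Mod Cmp),
    (∀ i, ψ.Sat (canonicalModel hT hg) (g i) ↔ sAt i ψ ∈ T) → ∀ i,
    ((α.diamond ψ).Sat (canonicalModel hT hg) (g i) ↔ sAt i (α.diamond ψ) ∈ T)
  | .mod a, ψ, hψ, i => by
    rw [Path.diamond, hT.dia_mem_iff]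
    simp only [Node.Sat, hg.exists, canonicalModel_R hT hg hgT, hψ]
  | .goto j, ψ, hψ, i => by
    simp only [Path.diamond, hT.sat_mem_iff, Node.Sat]
    exact hψ j
  | .test φ, ψ, hψ, i => by
    simp only [Path.diamond, hT.conj_mem_iff, Node.sat_conj, hψ, sat_canonicalModel hT hg hgT φ]
  | .comp α β, ψ, hψ, i =>
    sat_canonicalModel_diamond hT hg hgT α _ (sat_canonicalModel_diamond hT hg hgT β ψ hψ) i
/-- The truth lemma. -/
theorem sat_canonicalModel (hT : IsHenkin T) (hg : g.Surjective)
    (hgT : ∀ i j, g i = g j ↔ sAt i (.nom j) ∈ T) : ∀ (φ : Node Prp Nom Mod Cmp) (i : Nom),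
    φ.Sat (canonicalModel hT hg) (g i) ↔ sAt i φ ∈ T
  | .prop p, i => by
    have hi := (hgT _ _).1 (Function.surjInv_eq hg (g i))
    exact ⟨hT.transfer (.inl ⟨p, rfl⟩) hi, hT.transfer (.inl ⟨p, rfl⟩) (hT.nom_symm hi)⟩
  | .nom j, i => by
    rw [← hgT, eq_comm (a := g i)]
    rfl
  | .bot, i => by simp [Node.Sat, hT.bot_notMem]
  | .imp φ ψ, i => by
    simp only [Node.Sat, hT.imp_mem_iff, sat_canonicalModel hT hg hgT φ,
      sat_canonicalModel hT hg hgT ψ]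
  | .sat j φ, i => by
    rw [hT.sat_mem_iff]
    exact sat_canonicalModel hT hg hgT φ j
  | .dia a φ, i => by
    rw [hT.dia_mem_iff]
    simp only [Node.Sat, hg.exists, canonicalModel_R hT hg hgT, sat_canonicalModel hT hg hgT φ]
  | .data α d β, i => by
    have hnom (k l : Nom) : (Node.nom k).Sat (canonicalModel hT hg) (g l) ↔ sAt l (.nom k) ∈ T := by
      rw [← hgT, eq_comm (a := g l)]
      rfl
    have hα (k : Nom) : α.Sat (canonicalModel hT hg) (g i) (g k) ↔
        sAt i (α.diamond (.nom k)) ∈ T := by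
      rw [← sat_canonicalModel_diamond hT hg hgT α _ (hnom k), Path.sat_diamond_nom]
      rfl
    have hβ (k : Nom) : β.Sat (canonicalModel hT hg) (g i) (g k) ↔
        sAt i (β.diamond (.nom k)) ∈ T := by
      rw [← sat_canonicalModel_diamond hT hg hgT β _ (hnom k), Path.sat_diamond_nom]
      rfl
    simp only [Node.Sat, hT.data_mem_iff, hg.exists, canonicalModel_compare hT hg hgT, hα, hβ]
end

/-- The truth of a member of a sequent does not depend on the node of evaluation, so the truth
lemma decides whether it holds throughout the canonical model. -/
theorem canonicalModel_models_iff (hT : IsHenkin T) (hg : g.Surjective)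
    (hgT : ∀ i j, g i = g j ↔ sAt i (.nom j) ∈ T) (χ : SeqExpr Prp Nom Mod Cmp) :
    (canonicalModel hT hg).Models χ.1 ↔ χ ∈ T := by
  have := (canonicalModel hT hg).nonempty
  obtain ⟨_, ⟨i, φ, rfl⟩ | ⟨i, d, j, rfl⟩⟩ := χ
  · exact (forall_const W).trans (sat_canonicalModel hT hg hgT φ i)
  · refine Iff.trans ?_ (canonicalModel_compare hT hg hgT (d := d) (i := i) (j := j))
    simp only [Model.Models, Node.Sat, Path.Sat, exists_and_left, exists_eq_left', forall_const]
    rfl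

end Canonical

end HXPath

theorem mainTheorem1 {Prp : Type uP} {Nom : Type uN} {Mod : Type uM} {Cmp : Type uC}
    [Countable Prp] [Infinite Prp] [Countable Nom] [Infinite Nom] [Finite Mod] [Finite Cmp]
    (S : HXPath.Sequent Prp Nom Mod Cmp) (hS : HXPath.Sequent.Valid.{u} S) :
    S.Provable := by
  by_contra h
  obtain ⟨T, hT, hante, hcons⟩ := HXPath.exists_isHenkin h
  obtain ⟨W, g, hg, hgT⟩ := hT.exists_naming
  have hmodels := HXPath.canonicalModel_models_iff hT hg hgT
  obtain ⟨δ, hδ, hδT⟩ := hS W (HXPath.canonicalModel hT hg) fun γ hγ => (hmodels γ).2 (hante γ hγ)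
  exact hcons δ hδ ((hmodels δ).1 hδT)
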